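/- Let $m$ be a positive integer. A model of $T_m$ is a set $M$ together with a function $\mathrm{Sel}$ assigning to every $m$-element subset $X\subseteq M$ an element $\mathrm{Sel}(X)\in X$; submodels are subsets with the restricted function, and an isomorphism is a bijection $e$ with $e(\mathrm{Sel}(X))=\mathrm{Sel}(e[X])$ for all $m$-element sets $X$. There exists a model $\mathbf F$ of $T_m$ with domain $\omega$ such that (i) every nonempty finite model of $T_m$ is isomorphic to infinitely many submodels of $\mathbf F$, and (ii) every isomorphism between two finite submodels of $\mathbf F$ extends to an automorphism of $\mathbf F$. For any such $\mathbf F$, work in the universe of sets over the set of atoms $A=\omega$ (the domain of $\mathbf F$), let $G$ be the group of all permutations $\pi$ of $A$ with $\pi(\mathrm{Sel}(X))=\mathrm{Sel}(\pi[X])$ for every $m$-element $X\subseteq A$, and let $\mathcal V_m$ be the permutation model determined by $G$ and the normal ideal of finite subsets of $A$, i.e. the class of all hereditarily symmetric objects, where $x$ is symmetric if there is a finite $S\subseteq A$ such that every $\pi\in G$ fixing $S$ pointwise satisfies $\pi x=x$. Then $\mathcal V_m$ satisfies $\mathsf{RC}_m$: in $\mathcal V_m$, every infinite set $X$ has an infinite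 subset $Y\subseteq X$ such that the set $[Y]^m$ of $m$-element subsets of $Y$ has a choice function. -/

import Mathlib

universe u

/-! ### Models of the theory of a selector on `m`-element sets -/

/-- A model of `T_m` with domain `M`: a function selecting an element from every `m`-element
subset of `M`. -/
structure Selector (m : ℕ) (M : Type*) where
  sel : (s : Finset M) → s.card = m → M
  sel_mem : ∀ (s : Finset M) (h : s.card = m), sel s h ∈ s

namespace Selector

variable {m : ℕ} {M N : Type*}

/-- The submodel with domain `s`. -/
def restrict (F : Selector m M) (s : Finset M) : Selector m s where
  sel t h := ⟨F.sel (t.map (Function.Embedding.subtype _)) (by rw [Finset.card_map, h]), by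
    have := F.sel_mem (t.map (Function.Embedding.subtype _)) (by rw [Finset.card_map, h])
    obtain ⟨a, -, ha⟩ := Finset.mem_map.1 this
    rw [← ha]
    exact a.2⟩
  sel_mem t h := by
    have := F.sel_mem (t.map (Function.Embedding.subtype _)) (by rw [Finset.card_map, h])
    obtain ⟨a, hat, ha⟩ := Finset.mem_map.1 this
    convert hat
    exact ha.symm

/-- The bijection `e` is an isomorphism of `T_m`-models: `e (Sel X) = Sel (e X)` for every
`m`-element set `X`. -/
def IsIso (F : Selector m M) (G : Selector m N) (e : M ≃ N) : Prop :=
  ∀ (s : Finset M) (h : s.card = m),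
    e (F.sel s h) = G.sel (s.map e.toEmbedding) ((Finset.card_map _).trans h)

/-- Every nonempty finite model of `T_m` (with domain a finite set of natural numbers) is
isomorphic to infinitely many submodels of `F`. -/
def IsUniversal (F : Selector m ℕ) : Prop :=
  ∀ (M : Finset ℕ), M.Nonempty → ∀ G : Selector m M,
    {s : Finset ℕ | ∃ e : M ≃ s, G.IsIso (F.restrict s) e}.Infinite

/-- Every isomorphism between two finite submodels of `F` extends to an automorphism of `F`. -/
def IsHomogeneous (F : Selector m ℕ) : Prop :=
  ∀ (s t : Finset ℕ) (e : s ≃ t), (F.restrict s).IsIso (F.restrict t) e →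
    ∃ π : Equiv.Perm ℕ, F.IsIso F π ∧ ∀ a : s, π a = e a

/-- The group of automorphisms of `F`, that is, of the permutations `π` of the domain with
`π (Sel X) = Sel (π X)` for every `m`-element set `X`. -/
def autGroup (F : Selector m M) : Subgroup (Equiv.Perm M) where
  carrier := {π | F.IsIso F π}
  one_mem' s h := by
    have hs : s.map (1 : Equiv.Perm M).toEmbedding = s := Finset.map_refl
    simp only [Equiv.Perm.coe_one, id, hs]
  mul_mem' {π ρ} hπ hρ s h := by
    have hs : s.map (π * ρ).toEmbedding = (s.map ρ.toEmbedding).map π.toEmbedding := by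
      rw [Finset.map_map]
      rfl
    simp only [Equiv.Perm.coe_mul, Function.comp, hs]
    rw [hρ s h, hπ]
  inv_mem' {π} hπ s h := by
    have hs : (s.map (π⁻¹ : Equiv.Perm M).toEmbedding).map π.toEmbedding = s := by
      rw [Finset.map_map]
      convert Finset.map_refl
      ext a
      exact π.apply_symm_apply a
    have key := hπ (s.map (π⁻¹ : Equiv.Perm M).toEmbedding) ((Finset.card_map _).trans h)
    simp only [hs] at key
    rw [← key]
    exact π.symm_apply_apply _

end Selector

/-! ### The universe of sets with atoms -/

/-- Well-founded trees with leaves labelled by atoms: codes for sets over the atoms `A`. -/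
inductive PreZFA (A : Type) : Type (u + 1)
  | atom (a : A) : PreZFA A
  | set (ι : Type u) (f : ι → PreZFA A) : PreZFA A

namespace PreZFA

variable {A : Type}

/-- Extensional equality of codes; an atom equals only itself. -/
def Equal : PreZFA.{u} A → PreZFA.{u} A → Prop
  | atom a, atom b => a = b
  | set _ f, set _ g => (∀ i, ∃ j, Equal (f i) (g j)) ∧ ∀ j, ∃ i, Equal (f i) (g j)
  | atom _, set _ _ => False
  | set _ _, atom _ => False

theorem Equal.refl (x : PreZFA.{u} A) : Equal x x := by
  induction x with
  | atom a => simp [Equal]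
  | set ι f ih => exact ⟨fun i => ⟨i, ih i⟩, fun i => ⟨i, ih i⟩⟩

theorem Equal.symm {x y : PreZFA.{u} A} (h : Equal x y) : Equal y x := by
  induction x generalizing y with
  | atom a => cases y <;> simp_all [Equal]
  | set ι f ih =>
    cases y with
    | atom b => simp [Equal] at h
    | set κ g =>
      exact ⟨fun j => (h.2 j).imp fun i hi => ih i hi, fun i => (h.1 i).imp fun j hj => ih i hj⟩

theorem Equal.trans {x y z : PreZFA.{u} A} (h : Equal x y) (h' : Equal y z) : Equal x z := by
  induction x generalizing y z with
  | atom a => cases y <;> cases z <;> simp_all [Equal]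
  | set ι f ih =>
    cases y with
    | atom b => simp [Equal] at h
    | set κ g =>
      cases z with
      | atom c => simp [Equal] at h'
      | set l k =>
        refine ⟨fun i => ?_, fun j => ?_⟩
        · obtain ⟨a, ha⟩ := h.1 i
          obtain ⟨b, hb⟩ := h'.1 a
          exact ⟨b, ih i ha hb⟩
        · obtain ⟨a, ha⟩ := h'.2 j
          obtain ⟨b, hb⟩ := h.2 a
          exact ⟨b, ih b hb ha⟩

instance setoid (A : Type) : Setoid (PreZFA.{u} A) :=
  ⟨Equal, Equal.refl, Equal.symm, Equal.trans⟩

/-- The code `x` names an element of the set named by the second code; atoms have no elements. -/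
def Mem (x : PreZFA.{u} A) : PreZFA.{u} A → Prop
  | atom _ => False
  | set _ f => ∃ i, Equal x (f i)

def IsAtom : PreZFA.{u} A → Prop
  | atom _ => True
  | set _ _ => False

/-- A permutation of the atoms acts on all codes: `π x = {π y : y ∈ x}`. -/
def perm (π : Equiv.Perm A) : PreZFA.{u} A → PreZFA.{u} A
  | atom a => atom (π a)
  | set ι f => set ι fun i => perm π (f i)

theorem Mem.congr {x x' y y' : PreZFA.{u} A} (hx : Equal x x') (hy : Equal y y')
    (h : Mem x y) : Mem x' y' := by
  cases y with
  | atom a => exact h.elim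
  | set ι f =>
    cases y' with
    | atom b => exact hy.elim
    | set κ g =>
      obtain ⟨i, hi⟩ := h
      obtain ⟨j, hj⟩ := hy.1 i
      exact ⟨j, hx.symm.trans (hi.trans hj)⟩

theorem IsAtom.congr {x x' : PreZFA.{u} A} (hx : Equal x x') (h : IsAtom x) : IsAtom x' := by
  cases x <;> cases x' <;> simp_all [Equal, IsAtom]

theorem perm_congr (π : Equiv.Perm A) {x y : PreZFA.{u} A} (h : Equal x y) :
    Equal (perm π x) (perm π y) := by
  induction x generalizing y with
  | atom a => cases y <;> simp_all [Equal, perm]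
  | set ι f ih =>
    cases y with
    | atom b => exact h.elim
    | set κ g =>
      exact ⟨fun i => (h.1 i).imp fun j hj => ih i hj, fun j => (h.2 j).imp fun i hi => ih i hi⟩

end PreZFA

/-- The universe of all sets and atoms over the set `A` of atoms. -/
def ZFA (A : Type) : Type (u + 1) := Quotient (PreZFA.setoid.{u} A)

namespace ZFA

variable {A : Type}

def Mem (x y : ZFA.{u} A) : Prop :=
  Quotient.liftOn₂ x y PreZFA.Mem fun _ _ _ _ h h' =>
    propext ⟨PreZFA.Mem.congr h h', PreZFA.Mem.congr h.symm h'.symm⟩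

def IsAtom (x : ZFA.{u} A) : Prop :=
  Quotient.liftOn x PreZFA.IsAtom fun _ _ h =>
    propext ⟨PreZFA.IsAtom.congr h, PreZFA.IsAtom.congr h.symm⟩

/-- The action of a permutation of the atoms on the universe. -/
def perm (π : Equiv.Perm A) (x : ZFA.{u} A) : ZFA.{u} A :=
  Quotient.map (PreZFA.perm π) (fun _ _ h => PreZFA.perm_congr π h) x

/-- `x` is symmetric with respect to the group `G` and the normal ideal of finite sets of atoms:
some finite set `S` of atoms is a support of `x`, i.e. `fix_G(S) ⊆ sym_G(x)`. -/
def IsSymmetric (G : Subgroup (Equiv.Perm A)) (x : ZFA.{u} A) : Prop :=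
  ∃ S : Finset A, ∀ π ∈ G, (∀ a ∈ S, π a = a) → perm π x = x

/-- `x` is hereditarily symmetric. -/
inductive IsHereditarilySymmetric (G : Subgroup (Equiv.Perm A)) : ZFA.{u} A → Prop
  | intro (x : ZFA.{u} A) (symm : IsSymmetric G x)
      (mem : ∀ y, Mem y x → IsHereditarilySymmetric G y) : IsHereditarilySymmetric G x

end ZFA

/-! ### Set theory with atoms inside a structure -/

/-- A structure for the language of set theory with atoms. -/
class SetAtomStructure (M : Type*) extends Membership M M where
  IsAtom : M → Prop

/-- The permutation model given by the group `G` of permutations of the atoms and the normal ideal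
of finite sets of atoms: the class of all hereditarily symmetric objects. -/
def PermutationModel {A : Type} (G : Subgroup (Equiv.Perm A)) : Type (u + 1) :=
  {x : ZFA.{u} A // ZFA.IsHereditarilySymmetric G x}

instance {A : Type} (G : Subgroup (Equiv.Perm A)) :
    SetAtomStructure (PermutationModel.{u} G) where
  mem y x := ZFA.Mem x.1 y.1
  IsAtom x := ZFA.IsAtom x.1

/-! All quantifiers below range over the structure `M`, so these are the relativizations to `M` of
the usual notions. -/
namespace SetAtomStructure

variable {M : Type*} [SetAtomStructure M]

def IsSet (x : M) : Prop := ¬ IsAtom x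

/-- `y` is a subset of `x`. -/
def IsSubset (y x : M) : Prop := IsSet y ∧ ∀ z, z ∈ y → z ∈ x

/-- `p = {a, b}`. -/
def IsPair (p a b : M) : Prop := IsSet p ∧ ∀ z, z ∈ p ↔ z = a ∨ z = b

/-- `p = (a, b) = {{a}, {a, b}}`. -/
def IsOrderedPair (p a b : M) : Prop := ∃ s t, IsPair s a a ∧ IsPair t a b ∧ IsPair p s t

/-- `(a, b) ∈ f`. -/
def Maps (f a b : M) : Prop := ∃ p, p ∈ f ∧ IsOrderedPair p a b

/-- `f` is a function with domain `D`. -/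
def IsFunctionOn (f D : M) : Prop :=
  IsSet f ∧ (∀ p, p ∈ f → ∃ a b, a ∈ D ∧ IsOrderedPair p a b) ∧ ∀ a, a ∈ D → ∃! b, Maps f a b

/-- `f` is a bijection from `D` onto `X`. -/
def IsBijection (f D X : M) : Prop :=
  IsFunctionOn f D ∧ (∀ a b, Maps f a b → b ∈ X) ∧ ∀ b, b ∈ X → ∃! a, Maps f a b

def IsTransitiveSet (x : M) : Prop := IsSet x ∧ ∀ y, y ∈ x → ∀ z, z ∈ y → z ∈ x

/-- `x = ∅` or `x = k ∪ {k}` for some `k` (for sets `x`). -/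
def IsZeroOrSucc (x : M) : Prop := (∀ y, y ∉ x) ∨ ∃ k, ∀ y, y ∈ x ↔ y ∈ k ∨ y = k

/-- `n` is a von Neumann natural number: an ordinal (a transitive set of transitive sets) such that
`n` and all its elements are zero or successors. -/
def IsNatural (n : M) : Prop :=
  IsTransitiveSet n ∧ (∀ k, k ∈ n → IsTransitiveSet k) ∧
    IsZeroOrSucc n ∧ ∀ k, k ∈ n → IsZeroOrSucc k

/-- `X` is a finite set: there is a bijection from a natural number onto `X`. -/
def IsFinite (X : M) : Prop := IsSet X ∧ ∃ n f, IsNatural n ∧ IsBijection f n X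

def IsInfinite (X : M) : Prop := IsSet X ∧ ¬ IsFinite X

/-- `z` is a set with exactly `m` elements. -/
def HasCard (m : ℕ) (z : M) : Prop :=
  IsSet z ∧ ∃ x : Fin m → M, Function.Injective x ∧ ∀ y, y ∈ z ↔ ∃ i, y = x i

/-- `D = [Y]^m`, the set of all `m`-element subsets of `Y`. -/
def IsSubsetsOfCard (m : ℕ) (D Y : M) : Prop :=
  IsSet D ∧ ∀ z, z ∈ D ↔ IsSubset z Y ∧ HasCard m z

/-- `f` is a choice function on the family `D`. -/
def IsChoiceFunction (f D : M) : Prop := IsFunctionOn f D ∧ ∀ z v, Maps f z v → v ∈ z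

/-- The structure `M` satisfies `RC_m`: every infinite set `X` has an infinite subset `Y` such
that `[Y]^m` has a choice function. -/
def SatisfiesRC (m : ℕ) (M : Type*) [SetAtomStructure M] : Prop :=
  ∀ X : M, IsInfinite X → ∃ Y : M, IsSubset Y X ∧ IsInfinite Y ∧
    ∃ D f : M, IsSubsetsOfCard m D Y ∧ IsChoiceFunction f D

end SetAtomStructure

/-! Everything about `F` goes through `HasExtension`: over a finite set `s`, any single-valued
prescription of which old point is selected when a new point joins a subset of `s` is realized by
some new point. A selector with this property is built on ℕ by coding prescriptions into numbers
(`exists_hasExtension`). Back and forth (`IsPartialIso.exists_aut`) then yields homogeneity, and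
embedding a finite model point by point yields universality. Conversely `IsUniversal.hasExtension`
recovers the property for any `F` as in the theorem.

For `RC_m`, let `S` support the infinite set `X`. If `S` supports every element of `X`, any external
choice function on `[X]^m` is supported by `S`, so `Y = X` works. Otherwise take `x ∈ X` not
supported by `S` and add atoms of a support of `x` to `S` one at a time, reaching `E ⊇ S` and `a`
such that `E ∪ {a}` supports `x` and `E` does not. Let `Y` be the orbit of `x` under the
automorphisms fixing `E` pointwise; it lies in `X`. The crux, `apply_eq_of_smul_eq`, is that `g • x`
determines `g a`. Hence `Y` is in equivariant bijection with the orbit of `a` over `E`, which is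
infinite, and `Sel` on atoms pulls back to a choice function on `[Y]^m`.

The crux rests on amalgamation of types (`exists_amalgam`): if one `π` fixing `E` moved `a` but
fixed `x`, every `k` fixing `E` would fix `x`, so `E` would support `x`. -/

namespace Selector

variable {m : ℕ} {M : Type*}

/-! ### Finite partial isomorphisms between selectors. -/

/-- `F` selects `a` from the `m`-element set `s`. -/
def Picks (F : Selector m M) (s : Finset M) (a : M) : Prop :=
  ∃ h : s.card = m, F.sel s h = a

theorem Picks.card {F : Selector m M} {s : Finset M} {a : M} (h : F.Picks s a) : s.card = m := h.1

theorem Picks.mem {F : Selector m M} {s : Finset M} {a : M} (h : F.Picks s a) : a ∈ s := by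
  obtain ⟨h, rfl⟩ := h
  exact F.sel_mem s h

theorem Picks.unique {F : Selector m M} {s : Finset M} {a b : M} (h : F.Picks s a)
    (h' : F.Picks s b) : a = b := by
  obtain ⟨h, rfl⟩ := h
  obtain ⟨h', rfl⟩ := h'
  rfl

theorem exists_picks (F : Selector m M) {s : Finset M} (h : s.card = m) : ∃ a ∈ s, F.Picks s a :=
  ⟨_, F.sel_mem s h, h, rfl⟩

theorem IsIso.picks_map_iff {N : Type*} {F : Selector m M} {G : Selector m N} {e : M ≃ N}
    (he : F.IsIso G e) (s : Finset M) (a : M) :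
    G.Picks (s.map e.toEmbedding) (e a) ↔ F.Picks s a := by
  constructor
  · rintro ⟨h, h'⟩
    have hs : s.card = m := (Finset.card_map _).symm.trans h
    exact ⟨hs, e.injective ((he s hs).trans h')⟩
  · rintro ⟨h, rfl⟩
    exact ⟨(Finset.card_map _).trans h, (he s h).symm⟩

theorem restrict_picks_iff (F : Selector m M) (s : Finset M) (t : Finset s) (a : s) :
    (F.restrict s).Picks t a ↔ F.Picks (t.map (Function.Embedding.subtype _)) a := by
  constructor
  · rintro ⟨h, rfl⟩
    exact ⟨(Finset.card_map _).trans h, rfl⟩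
  · rintro ⟨h, h'⟩
    exact ⟨(Finset.card_map _).symm.trans h, Subtype.ext h'⟩

/-- The finite relation `r` is an isomorphism between the submodels on its domain and range. -/
def IsPartialIso (F G : Selector m ℕ) (r : Finset (ℕ × ℕ)) : Prop :=
  (∀ p ∈ r, ∀ q ∈ r, p.1 = q.1 ↔ p.2 = q.2) ∧
    ∀ t ⊆ r, ∀ p ∈ t, F.Picks (t.image Prod.fst) p.1 ↔ G.Picks (t.image Prod.snd) p.2

namespace IsPartialIso

variable {F G : Selector m ℕ} {r : Finset (ℕ × ℕ)}

theorem swap (h : IsPartialIso F G r) : IsPartialIso G F (r.image Prod.swap) := by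
  refine ⟨?_, fun t ht p hp => ?_⟩
  · intro p hp q hq
    obtain ⟨p, hp', rfl⟩ := Finset.mem_image.1 hp
    obtain ⟨q, hq', rfl⟩ := Finset.mem_image.1 hq
    exact (h.1 p hp' q hq').symm
  · have ht' : t.image Prod.swap ⊆ r := by
      intro q hq
      obtain ⟨q, hqt, rfl⟩ := Finset.mem_image.1 hq
      obtain ⟨q', hq', rfl⟩ := Finset.mem_image.1 (ht hqt)
      simpa using hq'
    have := h.2 _ ht' p.swap (Finset.mem_image_of_mem _ hp)
    simp only [Finset.image_image, Prod.fst_swap, Prod.snd_swap] at this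
    exact this.symm

theorem card_fst (h : IsPartialIso F G r) {t : Finset (ℕ × ℕ)} (ht : t ⊆ r) :
    (t.image Prod.fst).card = t.card :=
  Finset.card_image_of_injOn fun p hp q hq e =>
    Prod.ext e ((h.1 p (ht hp) q (ht hq)).1 e)

theorem card_snd (h : IsPartialIso F G r) {t : Finset (ℕ × ℕ)} (ht : t ⊆ r) :
    (t.image Prod.snd).card = t.card :=
  Finset.card_image_of_injOn fun p hp q hq e =>
    Prod.ext ((h.1 p (ht hp) q (ht hq)).2 e) e

end IsPartialIso

/-- A partial isomorphism is extended by a pair of new points as soon as these select the same old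
elements. -/
theorem IsPartialIso.insert_pair {F G : Selector m ℕ} {r : Finset (ℕ × ℕ)} (hr : IsPartialIso F G r)
    {a b : ℕ} (ha : a ∉ r.image Prod.fst) (hb : b ∉ r.image Prod.snd)
    (h : ∀ u ⊆ r, u.card + 1 = m → ∀ p ∈ u,
      F.Picks (insert a (u.image Prod.fst)) p.1 ↔ G.Picks (insert b (u.image Prod.snd)) p.2) :
    IsPartialIso F G (insert (a, b) r) := by
  have ha' : ∀ p ∈ r, p.1 ≠ a := fun p hp e => ha (Finset.mem_image.2 ⟨p, hp, e⟩)
  have hb' : ∀ p ∈ r, p.2 ≠ b := fun p hp e => hb (Finset.mem_image.2 ⟨p, hp, e⟩)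
  refine ⟨?_, fun t ht p hp => ?_⟩
  · intro p hp q hq
    rcases Finset.mem_insert.1 hp with rfl | hp <;> rcases Finset.mem_insert.1 hq with rfl | hq
    · simp
    · simp [(ha' q hq).symm, (hb' q hq).symm]
    · simp [ha' p hp, hb' p hp]
    · exact hr.1 p hp q hq
  · by_cases hab : (a, b) ∈ t
    · obtain ⟨u, hu, rfl⟩ : ∃ u, (a, b) ∉ u ∧ insert (a, b) u = t :=
        ⟨t.erase (a, b), Finset.notMem_erase _ _, Finset.insert_erase hab⟩
      have hur : u ⊆ r := (Finset.insert_subset_insert_iff hu).1 ht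
      have hau : a ∉ u.image Prod.fst := fun h => ha (Finset.image_subset_image hur h)
      have hbu : b ∉ u.image Prod.snd := fun h => hb (Finset.image_subset_image hur h)
      have c1 : (insert a (u.image Prod.fst)).card = u.card + 1 := by
        rw [Finset.card_insert_of_notMem hau, hr.card_fst hur]
      have c2 : (insert b (u.image Prod.snd)).card = u.card + 1 := by
        rw [Finset.card_insert_of_notMem hbu, hr.card_snd hur]
      rw [Finset.image_insert, Finset.image_insert]
      by_cases hm : u.card + 1 = m
      · have key := h u hur hm
        -- The hypothesis only speaks of old points. A new point is selected exactly when no old one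
        -- is, so its case follows by elimination.
        rcases Finset.mem_insert.1 hp with rfl | hp
        · constructor
          · intro hpa
            obtain ⟨c, hc, hcp⟩ := G.exists_picks (c2.trans hm)
            rcases Finset.mem_insert.1 hc with rfl | hc
            · exact hcp
            · obtain ⟨q, hq, rfl⟩ := Finset.mem_image.1 hc
              exact absurd (((key q hq).2 hcp).unique hpa) (ha' q (hur hq))
          · intro hpa
            obtain ⟨c, hc, hcp⟩ := F.exists_picks (c1.trans hm)
            rcases Finset.mem_insert.1 hc with rfl | hc
            · exact hcp
            · obtain ⟨q, hq, rfl⟩ := Finset.mem_image.1 hc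
              exact absurd (((key q hq).1 hcp).unique hpa) (hb' q (hur hq))
        · exact key p hp
      · exact ⟨fun h => absurd (c1.symm.trans h.card) hm, fun h => absurd (c2.symm.trans h.card) hm⟩
    · exact hr.2 t ((Finset.subset_insert_iff_of_notMem hab).1 ht) p hp

/-! ### The extension property and back and forth. -/

/-- The extension property: every one-point extension of a finite submodel is realized. -/
def HasExtension (F : Selector m ℕ) : Prop :=
  ∀ (s : Finset ℕ) (R : Finset ℕ → ℕ → Prop),
    (∀ t ⊆ s, ∀ b ∈ t, ∀ c ∈ t, R t b → R t c → b = c) →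
    ∃ n ∉ s, ∀ t ⊆ s, t.card + 1 = m → ∀ b ∈ t, F.Picks (insert n t) b ↔ R t b

theorem HasExtension.avoiding {F : Selector m ℕ} (hF : F.HasExtension) (s v : Finset ℕ)
    (R : Finset ℕ → ℕ → Prop) (hR : ∀ t ⊆ s, ∀ b ∈ t, ∀ c ∈ t, R t b → R t c → b = c) :
    ∃ n ∉ s, n ∉ v ∧ ∀ t ⊆ s, t.card + 1 = m → ∀ b ∈ t, F.Picks (insert n t) b ↔ R t b := by
  -- Counting `v` among the old points keeps `n` out of it; cutting the prescription down to `t ⊆ s`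
  -- preserves single-valuedness.
  obtain ⟨n, hn, h⟩ := hF (s ∪ v) (fun t b => t ⊆ s ∧ R t b)
    (fun t _ b hb c hc h h' => hR t h.1 b hb c hc h.2 h'.2)
  rw [Finset.notMem_union] at hn
  refine ⟨n, hn.1, hn.2, fun t ht hm b hb => ?_⟩
  rw [h t (ht.trans Finset.subset_union_left) hm b hb]
  exact and_iff_right ht

theorem IsPartialIso.extend_right {F G : Selector m ℕ} {r : Finset (ℕ × ℕ)}
    (hr : IsPartialIso F G r) (hG : G.HasExtension) (v : Finset ℕ) {a : ℕ}
    (ha : a ∉ r.image Prod.fst) : ∃ b ∉ v, IsPartialIso F G (insert (a, b) r) := by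
  classical
  -- The prescription is the type of `a` carried across `r`: the first projection of `r.filter (·.2
  -- ∈ t)` is the preimage of `t`.
  obtain ⟨b, hb, hbv, h⟩ := hG.avoiding (r.image Prod.snd) v
    (fun t b => ∃ p ∈ r, p.2 = b ∧
      F.Picks (insert a ((r.filter (·.2 ∈ t)).image Prod.fst)) p.1) (by
      rintro t ht _ hb _ hc ⟨p, hp, rfl, h⟩ ⟨q, hq, rfl, h'⟩
      exact (hr.1 p hp q hq).1 (h.unique h'))
  refine ⟨b, hbv, hr.insert_pair ha hb fun u hu hm p hp => ?_⟩
  rw [h _ (Finset.image_subset_image hu) (by rw [hr.card_snd hu, hm]) p.2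
    (Finset.mem_image_of_mem _ hp)]
  have hf : r.filter (·.2 ∈ u.image Prod.snd) = u := by
    ext q
    simp only [Finset.mem_filter, Finset.mem_image]
    constructor
    · rintro ⟨hq, q', hq', e⟩
      have : q' = q := Prod.ext ((hr.1 q' (hu hq') q hq).2 e) e
      exact this ▸ hq'
    · exact fun hq => ⟨hu hq, q, hq, rfl⟩
  rw [hf]
  constructor
  · exact fun h => ⟨p, hu hp, rfl, h⟩
  · rintro ⟨q, hq, e, h⟩
    rwa [(hr.1 q hq p (hu hp)).2 e] at h

theorem IsPartialIso.exists_right {F G : Selector m ℕ} {r : Finset (ℕ × ℕ)}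
    (hr : IsPartialIso F G r) (hG : G.HasExtension) (a : ℕ) :
    ∃ r', r ⊆ r' ∧ IsPartialIso F G r' ∧ ∃ b, (a, b) ∈ r' := by
  by_cases ha : a ∈ r.image Prod.fst
  · obtain ⟨p, hp, rfl⟩ := Finset.mem_image.1 ha
    exact ⟨r, subset_rfl, hr, p.2, hp⟩
  · obtain ⟨b, -, h⟩ := hr.extend_right hG ∅ ha
    exact ⟨_, Finset.subset_insert _ _, h, b, Finset.mem_insert_self _ _⟩

theorem IsPartialIso.exists_left {F G : Selector m ℕ} {r : Finset (ℕ × ℕ)}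
    (hr : IsPartialIso F G r) (hF : F.HasExtension) (b : ℕ) :
    ∃ r', r ⊆ r' ∧ IsPartialIso F G r' ∧ ∃ a, (a, b) ∈ r' := by
  obtain ⟨r', hrr, hr', a, ha⟩ := hr.swap.exists_right hF b
  refine ⟨r'.image Prod.swap, ?_, hr'.swap, a, ?_⟩
  · intro p hp
    exact Finset.mem_image.2 ⟨p.swap, hrr (Finset.mem_image_of_mem _ hp), Prod.swap_swap p⟩
  · exact Finset.mem_image.2 ⟨_, ha, rfl⟩

theorem isPartialIso_empty (F G : Selector m ℕ) : IsPartialIso F G ∅ := by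
  refine ⟨by simp, fun t ht p hp => ?_⟩
  exact absurd (ht hp) (Finset.notMem_empty _)

/-- Back and forth: a partial isomorphism extends to an automorphism. -/
theorem IsPartialIso.exists_aut {F : Selector m ℕ} (hF : F.HasExtension)
    {r : Finset (ℕ × ℕ)} (hr : IsPartialIso F F r) :
    ∃ π : Equiv.Perm ℕ, F.IsIso F π ∧ ∀ p ∈ r, π p.1 = p.2 := by
  classical
  let P := {r : Finset (ℕ × ℕ) // IsPartialIso F F r}
  -- Countably many cofinal sets: `a` is in the domain, `b` is in the range. The union of an ideal
  -- meeting them all is the graph of a permutation.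
  let D : ℕ ⊕ ℕ → Order.Cofinal P := fun i =>
    { carrier := Sum.elim (fun a => {r | ∃ b, (a, b) ∈ r.1}) (fun b => {r | ∃ a, (a, b) ∈ r.1}) i
      isCofinal := by
        intro q
        cases i with
        | inl a =>
          obtain ⟨r', h, h', hb⟩ := q.2.exists_right hF a
          exact ⟨⟨r', h'⟩, hb, h⟩
        | inr b =>
          obtain ⟨r', h, h', hb⟩ := q.2.exists_left hF b
          exact ⟨⟨r', h'⟩, hb, h⟩ }
  let p₀ : P := ⟨r, hr⟩
  let I := Order.idealOfCofinals p₀ D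
  have hI₀ : p₀ ∈ I := Order.mem_idealOfCofinals p₀ D
  have hright : ∀ a, ∃ b, ∃ q ∈ I, (a, b) ∈ q.1 := fun a => by
    obtain ⟨q, ⟨b, hb⟩, hq⟩ := Order.cofinal_meets_idealOfCofinals p₀ D (Sum.inl a)
    exact ⟨b, q, hq, hb⟩
  have hleft : ∀ b, ∃ a, ∃ q ∈ I, (a, b) ∈ q.1 := fun b => by
    obtain ⟨q, ⟨a, ha⟩, hq⟩ := Order.cofinal_meets_idealOfCofinals p₀ D (Sum.inr b)
    exact ⟨a, q, hq, ha⟩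
  choose f hf using hright
  choose g hg using hleft
  have huniq : ∀ {a b a' b'}, (∃ q ∈ I, (a, b) ∈ q.1) → (∃ q ∈ I, (a', b') ∈ q.1) →
      (a = a' ↔ b = b') := by
    rintro a b a' b' ⟨q, hq, h⟩ ⟨q', hq', h'⟩
    obtain ⟨q'', -, h1, h2⟩ := I.directed q hq q' hq'
    exact q''.2.1 _ (h1 h) _ (h2 h')
  let π : Equiv.Perm ℕ := ⟨f, g, fun a => (huniq (hg (f a)) (hf a)).2 rfl,
    fun b => (huniq (hf (g b)) (hg b)).1 rfl⟩
  -- A selection involves finitely many points, so directedness puts all the relevant pairs into one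
  -- member of the ideal.
  have hfin : ∀ s : Finset ℕ, ∃ q ∈ I, s.image (fun a => (a, f a)) ⊆ q.1 := by
    intro s
    induction s using Finset.induction_on with
    | empty => exact ⟨p₀, hI₀, by simp⟩
    | insert a s _ ih =>
      obtain ⟨q, hq, h⟩ := ih
      obtain ⟨q', hq', h'⟩ := hf a
      obtain ⟨q'', hI, h1, h2⟩ := I.directed q hq q' hq'
      refine ⟨q'', hI, ?_⟩
      rw [Finset.image_insert, Finset.insert_subset_iff]
      exact ⟨h2 h', h.trans h1⟩
  refine ⟨π, fun s h => ?_, fun p hp => (huniq (hf p.1) ⟨p₀, hI₀, hp⟩).1 rfl⟩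
  obtain ⟨q, -, hq⟩ := hfin s
  have := q.2.2 _ hq (F.sel s h, f (F.sel s h)) (Finset.mem_image_of_mem _ (F.sel_mem s h))
  simp only [Finset.image_image, Function.comp_def, Finset.image_id'] at this
  have hs : s.map π.toEmbedding = s.image f := by
    rw [Finset.map_eq_image]; rfl
  obtain ⟨h1, h2⟩ := this.1 ⟨h, rfl⟩
  simp only [hs]
  exact h2.symm

theorem isPartialIso_graph_iff {F G : Selector m ℕ} {s : Finset ℕ} {φ : ℕ → ℕ} :
    IsPartialIso F G (s.image fun a => (a, φ a)) ↔ Set.InjOn φ s ∧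
      ∀ t ⊆ s, ∀ a ∈ t, F.Picks t a ↔ G.Picks (t.image φ) (φ a) := by
  constructor
  · intro h
    refine ⟨fun a ha b hb e => ?_, fun t ht a ha => ?_⟩
    · exact (h.1 (a, φ a) (Finset.mem_image_of_mem _ ha) (b, φ b)
        (Finset.mem_image_of_mem _ hb)).2 e
    · have := h.2 (t.image fun a => (a, φ a)) (Finset.image_subset_image ht) (a, φ a)
        (Finset.mem_image_of_mem _ ha)
      simpa only [Finset.image_image, Function.comp_def, Finset.image_id'] using this
  · rintro ⟨hinj, h⟩
    refine ⟨fun p hp q hq => ?_, fun t ht p hp => ?_⟩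
    · obtain ⟨a, ha, rfl⟩ := Finset.mem_image.1 hp
      obtain ⟨b, hb, rfl⟩ := Finset.mem_image.1 hq
      exact ⟨fun e => congrArg φ e, fun e => hinj ha hb e⟩
    · obtain ⟨u, hu, rfl⟩ := Finset.subset_image_iff.1 ht
      obtain ⟨a, ha, rfl⟩ := Finset.mem_image.1 hp
      have := h u (by exact_mod_cast hu) a ha
      simpa only [Finset.image_image, Function.comp_def, Finset.image_id'] using this

theorem IsIso.isPartialIso {F G : Selector m ℕ} {s t : Finset ℕ} {e : s ≃ t}
    (he : (F.restrict s).IsIso (G.restrict t) e) {φ : ℕ → ℕ} (hφ : ∀ a : s, φ a = e a) :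
    IsPartialIso F G (s.image fun a => (a, φ a)) := by
  rw [isPartialIso_graph_iff]
  refine ⟨fun a ha b hb h => ?_, fun u hu a ha => ?_⟩
  · have := (hφ ⟨a, ha⟩).symm.trans (h.trans (hφ ⟨b, hb⟩))
    exact congrArg Subtype.val (e.injective (Subtype.ext this))
  · let v : Finset s := Finset.univ.filter (fun a => a.1 ∈ u)
    have h1 : v.map (Function.Embedding.subtype _) = u := by
      ext x
      simp only [v, Finset.mem_map, Finset.mem_filter, Finset.mem_univ, true_and,
        Function.Embedding.coe_subtype, Subtype.exists, exists_and_left, exists_prop]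
      exact ⟨fun ⟨y, h, _, e⟩ => e ▸ h, fun h => ⟨x, h, hu h, rfl⟩⟩
    have h2 : (v.map e.toEmbedding).map (Function.Embedding.subtype _) = u.image φ := by
      rw [← h1, Finset.map_map, Finset.map_eq_image, Finset.map_eq_image, Finset.image_image]
      exact Finset.image_congr fun x _ => (hφ x).symm
    have key := he.picks_map_iff v ⟨a, hu ha⟩
    rw [restrict_picks_iff, restrict_picks_iff, h1, h2, ← hφ] at key
    exact key.symm

theorem IsPartialIso.exists_isIso {F G : Selector m ℕ} {r : Finset (ℕ × ℕ)}
    (hr : IsPartialIso F G r) :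
    ∃ e : r.image Prod.fst ≃ r.image Prod.snd,
      (F.restrict _).IsIso (G.restrict _) e ∧ ∀ a, (a.1, (e a).1) ∈ r := by
  classical
  have hf : ∀ a : r.image Prod.fst, ∃ b : r.image Prod.snd, (a.1, b.1) ∈ r := by
    rintro ⟨a, ha⟩
    obtain ⟨p, hp, rfl⟩ := Finset.mem_image.1 ha
    exact ⟨⟨p.2, Finset.mem_image_of_mem _ hp⟩, hp⟩
  have hg : ∀ b : r.image Prod.snd, ∃ a : r.image Prod.fst, (a.1, b.1) ∈ r := by
    rintro ⟨a, ha⟩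
    obtain ⟨p, hp, rfl⟩ := Finset.mem_image.1 ha
    exact ⟨⟨p.1, Finset.mem_image_of_mem _ hp⟩, hp⟩
  choose f hf using hf
  choose g hg using hg
  refine ⟨⟨f, g, fun a => Subtype.ext ((hr.1 _ (hg (f a)) _ (hf a)).2 rfl),
    fun b => Subtype.ext ((hr.1 _ (hf (g b)) _ (hg b)).1 rfl)⟩, fun s h => ?_, hf⟩
  set e : r.image Prod.fst ≃ r.image Prod.snd := ⟨f, g, _, _⟩ with he
  have key := hr.2 (s.image fun a => (a.1, (f a).1))
    (fun p hp => by
      obtain ⟨a, -, rfl⟩ := Finset.mem_image.1 hp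
      exact hf a) (_, _) (Finset.mem_image_of_mem _ ((F.restrict _).sel_mem s h))
  have h1 : (s.image fun a => (a.1, (f a).1)).image Prod.fst =
      s.map (Function.Embedding.subtype _) := by
    rw [Finset.image_image, Finset.map_eq_image]; rfl
  have h2 : (s.image fun a => (a.1, (f a).1)).image Prod.snd =
      (s.map e.toEmbedding).map (Function.Embedding.subtype _) := by
    rw [Finset.image_image, Finset.map_map, Finset.map_eq_image]; rfl
  rw [h1, h2, ← restrict_picks_iff, ← restrict_picks_iff] at key
  obtain ⟨_, h4⟩ := key.1 ⟨h, rfl⟩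
  exact h4.symm

theorem HasExtension.isHomogeneous {F : Selector m ℕ} (hF : F.HasExtension) :
    F.IsHomogeneous := by
  classical
  intro s t e he
  let φ : ℕ → ℕ := fun a => if h : a ∈ s then e ⟨a, h⟩ else 0
  have hφ : ∀ a : s, φ a = e a := fun a => by simp [φ]
  obtain ⟨π, hπ, h⟩ := (he.isPartialIso hφ).exists_aut hF
  exact ⟨π, hπ, fun a => (h (a, φ a) (Finset.mem_image.2 ⟨a, a.2, rfl⟩)).trans (hφ a)⟩

/-! ### Universality, and existence of a selector with the extension property. -/

/-- Lets a finite model be treated as part of a selector on ℕ, where `IsPartialIso` applies; outside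
`M` the selection is arbitrary. -/
theorem exists_restrict_eq (hm : 0 < m) (M : Finset ℕ) (G : Selector m M) :
    ∃ G' : Selector m ℕ, G'.restrict M = G := by
  classical
  have hne : ∀ s : Finset ℕ, s.card = m → s.Nonempty := fun s h =>
    Finset.card_pos.1 (h ▸ hm)
  have key : ∀ (s : Finset ℕ) (h : s.card = m), ∃ a ∈ s,
      ∀ (t : Finset M) (ht : t.card = m), t.map (Function.Embedding.subtype _) = s →
        a = G.sel t ht := by
    intro s h
    by_cases hs : ∃ t : Finset M, t.map (Function.Embedding.subtype _) = s
    · obtain ⟨t, rfl⟩ := hs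
      have ht : t.card = m := (Finset.card_map _).symm.trans h
      refine ⟨G.sel t ht, Finset.mem_map_of_mem _ (G.sel_mem t ht), fun t' ht' e => ?_⟩
      obtain rfl := Finset.map_injective _ e
      rfl
    · obtain ⟨a, ha⟩ := hne s h
      exact ⟨a, ha, fun t _ e => absurd ⟨t, e⟩ hs⟩
  choose f hf hf' using key
  refine ⟨⟨f, hf⟩, ?_⟩
  obtain ⟨g, hg⟩ := G
  have : ((⟨f, hf⟩ : Selector m ℕ).restrict M).sel = g := by
    funext t ht
    exact Subtype.ext (hf' _ _ t ht rfl)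
  unfold restrict at this ⊢
  simp only at this
  simp only [this]

theorem HasExtension.exists_isPartialIso {F : Selector m ℕ} (hF : F.HasExtension)
    (G : Selector m ℕ) (v M : Finset ℕ) :
    ∃ r, IsPartialIso G F r ∧ r.image Prod.fst = M ∧ Disjoint (r.image Prod.snd) v := by
  induction M using Finset.induction_on with
  | empty => exact ⟨∅, isPartialIso_empty G F, by simp, by simp⟩
  | insert a s ha ih =>
    obtain ⟨r, hr, rfl, hd⟩ := ih
    obtain ⟨b, hb, h⟩ := hr.extend_right hF v ha
    refine ⟨_, h, by rw [Finset.image_insert], ?_⟩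
    rw [Finset.image_insert, Finset.disjoint_insert_left]
    exact ⟨hb, hd⟩

theorem HasExtension.isUniversal (hm : 0 < m) {F : Selector m ℕ} (hF : F.HasExtension) :
    F.IsUniversal := by
  intro M hM G hfin
  obtain ⟨G', rfl⟩ := exists_restrict_eq hm M G
  -- `hfin.toFinset.sup id` is the union of the supposedly finitely many copies. A copy disjoint
  -- from it is also contained in it, hence empty.
  obtain ⟨r, hr, rfl, hd⟩ := hF.exists_isPartialIso G' (hfin.toFinset.sup id) M
  obtain ⟨e, he, -⟩ := hr.exists_isIso
  have hmem := hfin.mem_toFinset.2 ⟨e, he⟩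
  have hsub : r.image Prod.snd ⊆ hfin.toFinset.sup id := Finset.le_sup (f := id) hmem
  have hempty := Finset.disjoint_self_iff_empty _ |>.1 (hd.mono_right hsub)
  rw [Finset.image_eq_empty] at hempty
  subst hempty
  simp at hM

open Classical in
/-- An element satisfying `P`, or the default value `n` if there is none. -/
noncomputable def chooseOr (P : ℕ → Prop) (n : ℕ) : ℕ :=
  if h : ∃ b, P b then h.choose else n

/-- The default `n` will be the new point, standing for "no old point is selected"; `b ≠ n` keeps it
apart from genuine witnesses. -/
theorem chooseOr_eq_iff {P : ℕ → Prop} {n b : ℕ} (hP : ∀ a b, P a → P b → a = b) (hb : b ≠ n) :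
    chooseOr P n = b ↔ P b := by
  unfold chooseOr
  split_ifs with h
  · exact ⟨fun e => e ▸ h.choose_spec, fun hb => hP _ _ h.choose_spec hb⟩
  · exact ⟨fun e => absurd e.symm hb, fun hb => absurd ⟨b, hb⟩ h⟩

theorem chooseOr_mem {P : ℕ → Prop} {n : ℕ} {s : Finset ℕ} (hP : ∀ b, P b → b ∈ s) (hn : n ∈ s) :
    chooseOr P n ∈ s := by
  unfold chooseOr
  split_ifs with h
  · exact hP _ h.choose_spec
  · exact hn

/-- A selector with the extension property: the selection from a set with largest element `n` is
determined by the finite set of instructions coded by `n`, each of which is used infinitely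
often. -/
theorem exists_hasExtension (hm : 0 < m) : ∃ F : Selector m ℕ, F.HasExtension := by
  classical
  obtain ⟨f, hf⟩ := exists_surjective_nat (Finset (Finset ℕ × ℕ))
  have hne : ∀ s : Finset ℕ, s.card = m → s.Nonempty := fun s h =>
    Finset.card_pos.1 (h ▸ hm)
  let F : Selector m ℕ :=
    { sel := fun s h => chooseOr (fun b => b ∈ s.erase (s.max' (hne s h)) ∧
        (s.erase (s.max' (hne s h)), b) ∈ f (Nat.unpair (s.max' (hne s h))).2) (s.max' (hne s h))
      sel_mem := fun s h => chooseOr_mem (fun b hb => Finset.mem_of_mem_erase hb.1)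
        (Finset.max'_mem _ _) }
  refine ⟨F, fun s R hR => ?_⟩
  obtain ⟨i, hi⟩ := hf ((s.powerset ×ˢ s).filter fun p => p.2 ∈ p.1 ∧ R p.1 p.2)
  -- The second coordinate codes the prescription; the first forces `n` above all of `s`, so that
  -- `n` is the maximum of `insert n t`.
  let n := Nat.pair (s.sup id + 1) i
  have hlt : ∀ a ∈ s, a < n := fun a ha =>
    (Nat.lt_succ_of_le (Finset.le_sup (f := id) ha)).trans_le (Nat.left_le_pair _ _)
  have hns : n ∉ s := fun h => lt_irrefl _ (hlt n h)
  refine ⟨n, hns, fun t ht hmt b hb => ?_⟩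
  have hnt : n ∉ t := fun h => hns (ht h)
  have hcard : (insert n t).card = m := by rw [Finset.card_insert_of_notMem hnt, hmt]
  have hmax : (insert n t).max' (hne _ hcard) = n := by
    refine le_antisymm (Finset.max'_le _ _ _ fun a ha => ?_)
      (Finset.le_max' _ _ (Finset.mem_insert_self _ _))
    rcases Finset.mem_insert.1 ha with rfl | ha
    · exact le_rfl
    · exact (hlt a (ht ha)).le
  have hR' : ∀ c, (c ∈ t ∧ (t, c) ∈ f i) ↔ c ∈ t ∧ R t c := by
    intro c
    rw [hi]
    simp only [Finset.mem_filter, Finset.mem_product, Finset.mem_powerset]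
    exact ⟨fun h => h.2.2, fun h => ⟨h.1, ⟨ht, ht h.1⟩, h⟩⟩
  have hsel : F.sel (insert n t) hcard = chooseOr (fun b => b ∈ t ∧ R t b) n := by
    change chooseOr _ _ = _
    simp only [hmax, Finset.erase_insert hnt]
    simp only [n, Nat.unpair_pair, hR']
  have hch := chooseOr_eq_iff (P := fun b => b ∈ t ∧ R t b) (n := n) (b := b)
    (fun a b ha hb => hR t ht a ha.1 b hb.1 ha.2 hb.2) (fun e => hnt (e ▸ hb))
  rw [show F.Picks (insert n t) b ↔ F.sel (insert n t) hcard = b from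
    ⟨fun h => h.2, fun h => ⟨hcard, h⟩⟩, hsel, hch]
  exact and_iff_right hb

/-! ### From universality and homogeneity back to the extension property. -/

theorem IsUniversal.exists_isPartialIso {F : Selector m ℕ} (hF : F.IsUniversal)
    (G : Selector m ℕ) {M : Finset ℕ} (hM : M.Nonempty) :
    ∃ φ : ℕ → ℕ, IsPartialIso G F (M.image fun a => (a, φ a)) := by
  classical
  obtain ⟨s, e, he⟩ := (hF M hM (G.restrict M)).nonempty
  exact ⟨fun a => if h : a ∈ M then e ⟨a, h⟩ else 0, he.isPartialIso fun a => by simp⟩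

theorem IsHomogeneous.exists_aut {F : Selector m ℕ} (hF : F.IsHomogeneous)
    {r : Finset (ℕ × ℕ)} (hr : IsPartialIso F F r) :
    ∃ π ∈ F.autGroup, ∀ p ∈ r, π p.1 = p.2 := by
  obtain ⟨e, he, h⟩ := hr.exists_isIso
  obtain ⟨π, hπ, h'⟩ := hF _ _ e he
  refine ⟨π, hπ, fun p hp => ?_⟩
  have := h' ⟨p.1, Finset.mem_image_of_mem _ hp⟩
  rw [this]
  exact (hr.1 _ (h ⟨p.1, Finset.mem_image_of_mem _ hp⟩) _ hp).1 rfl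

theorem IsUniversal.hasExtension {F : Selector m ℕ} (hF : F.IsUniversal)
    (hF' : F.IsHomogeneous) : F.HasExtension := by
  classical
  intro s R hR
  obtain ⟨n₀, hn₀⟩ := Infinite.exists_notMem_finset s
  -- The desired one-point extension of `s`, with `n₀` as its new point. Universality embeds it in
  -- `F` by `φ`, but this may move `s`.
  let G : Selector m ℕ :=
    { sel := fun t h => if n₀ ∈ t then
        chooseOr (fun b => t.erase n₀ ⊆ s ∧ b ∈ t.erase n₀ ∧ R (t.erase n₀) b) n₀ else F.sel t h
      sel_mem := fun t h => by
        split_ifs with h'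
        · exact chooseOr_mem (fun b hb => Finset.mem_of_mem_erase hb.2.1) h'
        · exact F.sel_mem t h }
  have hG : ∀ t ⊆ s, ∀ a, G.Picks t a ↔ F.Picks t a := by
    intro t ht a
    have : ∀ h, G.sel t h = F.sel t h := fun h => if_neg fun h' => hn₀ (ht h')
    simp only [Picks, this]
  obtain ⟨φ, hφ⟩ := hF.exists_isPartialIso G (Finset.insert_nonempty n₀ s)
  rw [isPartialIso_graph_iff] at hφ
  obtain ⟨hinj, hφ⟩ := hφ
  have hss := Finset.subset_insert n₀ s
  have hsF : IsPartialIso F F (s.image fun a => (a, φ a)) := isPartialIso_graph_iff.2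
    ⟨hinj.mono (by exact_mod_cast hss), fun t ht a ha =>
      (hG t ht a).symm.trans (hφ t (ht.trans hss) a ha)⟩
  obtain ⟨π, hπ, hπφ⟩ := hF'.exists_aut hsF
  have hπφ : ∀ a ∈ s, π a = φ a := fun a ha => hπφ (a, φ a) (Finset.mem_image_of_mem _ ha)
  have hn : π (π.symm (φ n₀)) = φ n₀ := π.apply_symm_apply _
  -- Homogeneity gave an automorphism `π` agreeing with `φ` on `s`; undoing it brings the copy of
  -- `s` back to `s` and `φ n₀` to the wanted point.
  refine ⟨π.symm (φ n₀), fun h => ?_, fun t ht hmt b hb => ?_⟩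
  · rw [hπφ _ h] at hn
    have := hinj (hss h) (Finset.mem_insert_self _ _) hn
    exact hn₀ (this ▸ h)
  · have hmap : (insert (π.symm (φ n₀)) t).map π.toEmbedding = (insert n₀ t).image φ := by
      rw [Finset.map_eq_image, Finset.image_insert, Finset.image_insert]
      congr 1
      exact Finset.image_congr fun a ha => hπφ a (ht ha)
    have hnt : n₀ ∉ t := fun h => hn₀ (ht h)
    have hcard : (insert n₀ t).card = m := by rw [Finset.card_insert_of_notMem hnt, hmt]
    have hsel : G.sel (insert n₀ t) hcard = chooseOr (fun b => b ∈ t ∧ R t b) n₀ := by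
      change (if _ then _ else _) = _
      rw [if_pos (Finset.mem_insert_self _ _)]
      simp only [Finset.erase_insert hnt, ht, true_and]
    have hch := chooseOr_eq_iff (P := fun b => b ∈ t ∧ R t b) (n := n₀) (b := b)
      (fun a b ha hb => hR t ht a ha.1 b hb.1 ha.2 hb.2) (fun e => hnt (e ▸ hb))
    rw [← IsIso.picks_map_iff hπ, hmap, hπφ b (ht hb),
      ← hφ _ (Finset.insert_subset_insert _ ht) b (Finset.mem_insert_of_mem hb),
      show G.Picks (insert n₀ t) b ↔ G.sel (insert n₀ t) hcard = b from
        ⟨fun h => h.2, fun h => ⟨hcard, h⟩⟩, hsel, hch]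
    exact and_iff_right hb

/-! ### Types over finite sets, and recovering an atom from an object it supports. -/

/-- Points of the same type over a finite set are conjugate over it. -/
theorem IsHomogeneous.exists_aut_fixing {F : Selector m ℕ} (hF : F.IsHomogeneous) {t : Finset ℕ}
    {b e : ℕ} (hb : b ∉ t) (he : e ∉ t)
    (h : ∀ u ⊆ t, u.card + 1 = m → ∀ x ∈ u, F.Picks (insert b u) x ↔ F.Picks (insert e u) x) :
    ∃ π ∈ F.autGroup, (∀ x ∈ t, π x = x) ∧ π b = e := by
  have h0 : IsPartialIso F F (t.image fun a => (a, id a)) :=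
    isPartialIso_graph_iff.2 ⟨Function.injective_id.injOn, fun u _ a _ => by simp⟩
  have h1 := h0.insert_pair (a := b) (b := e) (by simpa using hb) (by simpa using he) (by
    intro u hu hm p hp
    obtain ⟨v, hv, rfl⟩ := Finset.subset_image_iff.1 hu
    obtain ⟨x, hx, rfl⟩ := Finset.mem_image.1 hp
    simp only [Finset.image_image, Function.comp_def, id, Finset.image_id']
    refine h v (by exact_mod_cast hv) ?_ x hx
    rwa [Finset.card_image_of_injective _ fun a b h => congrArg Prod.fst h] at hm)
  obtain ⟨π, hπ, h2⟩ := hF.exists_aut h1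
  exact ⟨π, hπ, fun x hx => h2 (x, x)
    (Finset.mem_insert_of_mem (Finset.mem_image_of_mem (fun a => (a, id a)) hx)),
    h2 (b, e) (Finset.mem_insert_self _ _)⟩

/-- An orbit over a finite set, of a point outside it, is infinite. -/
theorem exists_aut_notMem {F : Selector m ℕ} (hF : F.HasExtension) (hF' : F.IsHomogeneous)
    {E : Finset ℕ} {a : ℕ} (ha : a ∉ E) (v : Finset ℕ) :
    ∃ π ∈ F.autGroup, (∀ x ∈ E, π x = x) ∧ π a ∉ v := by
  -- Realize the type of `a` over `E` by a point outside `v`; homogeneity moves `a` there.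
  obtain ⟨n, hn, hnv, h⟩ := hF.avoiding E v (fun t b => F.Picks (insert a t) b)
    (fun t _ b _ c _ h h' => h.unique h')
  obtain ⟨π, hπ, h1, rfl⟩ := hF'.exists_aut_fixing ha hn fun u hu hm x hx => (h u hu hm x hx).symm
  exact ⟨π, hπ, h1, hnv⟩

/-- If `b` and `b'` have the same type over `E`, some point has the type of `b` over `E ∪ {c}` and
the type of `b'` over `E ∪ {d}`. -/
theorem exists_amalgam {F : Selector m ℕ} (hF : F.HasExtension) (hF' : F.IsHomogeneous)
    {E : Finset ℕ} {b b' c d : ℕ} (hcd : c ≠ d) (hc : c ∉ E) (hd : d ∉ E)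
    (hb : b ∉ insert c E) (hb' : b' ∉ insert d E)
    (h : ∀ t ⊆ E, ∀ x ∈ t, F.Picks (insert b t) x ↔ F.Picks (insert b' t) x) :
    ∃ π ∈ F.autGroup, ∃ ρ ∈ F.autGroup, (∀ x ∈ insert c E, π x = x) ∧
      (∀ x ∈ insert d E, ρ x = x) ∧ π b = ρ b' := by
  -- Sets containing both `c` and `d` are bound by neither requirement, so no old point is
  -- prescribed there. On subsets of `E` the two types coincide and the first clause serves both.
  obtain ⟨e, he, hR⟩ := hF (insert c (insert d E))
    (fun t x => d ∉ t ∧ F.Picks (insert b t) x ∨ d ∈ t ∧ c ∉ t ∧ F.Picks (insert b' t) x) (by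
      rintro t - x - y - (⟨h1, h2⟩ | ⟨h1, h2, h3⟩) (⟨h4, h5⟩ | ⟨h4, h5, h6⟩)
      · exact h2.unique h5
      · exact absurd h4 h1
      · exact absurd h1 h4
      · exact h3.unique h6)
  have hc' : insert c E ⊆ insert c (insert d E) :=
    Finset.insert_subset_insert _ (Finset.subset_insert _ _)
  have hd' : insert d E ⊆ insert c (insert d E) := Finset.subset_insert _ _
  obtain ⟨π, hπ, h1, h2⟩ := hF'.exists_aut_fixing hb (fun h => he (hc' h)) (by
    intro u hu hm x hx
    have hdu : d ∉ u := fun h => (Finset.mem_insert.1 (hu h)).elim (fun e => hcd e.symm) hd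
    rw [hR u (hu.trans hc') hm x hx]
    simp [hdu])
  obtain ⟨ρ, hρ, h3, h4⟩ := hF'.exists_aut_fixing hb' (fun h => he (hd' h)) (by
    intro u hu hm x hx
    have hcu : c ∉ u := fun h => (Finset.mem_insert.1 (hu h)).elim hcd hc
    rw [hR u (hu.trans hd') hm x hx]
    by_cases hdu : d ∈ u
    · simp [hdu, hcu]
    · have huE : u ⊆ E := fun y hy => (Finset.mem_insert.1 (hu hy)).resolve_left
        fun e => hdu (e ▸ hy)
      simp [hdu, h u huE x hx])
  exact ⟨π, hπ, ρ, hρ, h1, h3, h2.trans h4.symm⟩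

/-- In an action of the automorphism group, if `x` is supported by `E ∪ {a}` but not by `E`, then
`a` can be recovered from `x` over `E`. -/
theorem apply_eq_of_smul_eq {F : Selector m ℕ} (hF : F.HasExtension) (hF' : F.IsHomogeneous)
    {Z : Type*} [MulAction F.autGroup Z] {E : Finset ℕ} {a : ℕ} {x : Z}
    (hx : ∀ g : F.autGroup, (∀ y ∈ insert a E, g.1 y = y) → g • x = x)
    (hx' : ¬ ∀ g : F.autGroup, (∀ y ∈ E, g.1 y = y) → g • x = x)
    {g h : F.autGroup} (hg : ∀ y ∈ E, g.1 y = y) (hh : ∀ y ∈ E, h.1 y = y)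
    (hgh : g • x = h • x) : g.1 a = h.1 a := by
  by_contra hne
  have haE : a ∉ E := fun ha => hx' (by rwa [Finset.insert_eq_of_mem ha] at hx)
  have hout : ∀ q : F.autGroup, (∀ y ∈ E, q.1 y = y) → ∀ y ∉ E, q.1 y ∉ E := fun q hq y hy h =>
    hy (q.1.injective (hq _ h) ▸ h)
  have hmul : ∀ p q : F.autGroup, (∀ y ∈ E, p.1 y = y) → (∀ y ∈ E, q.1 y = y) →
      ∀ y ∈ E, (p * q).1 y = y := fun p q hp hq y hy => (congrArg p.1 (hq y hy)).trans (hp y hy)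
  have hinv : ∀ q : F.autGroup, ∀ y, q.1 y = y → (q⁻¹).1 y = y := fun q y hy =>
    q.1.symm_apply_eq.2 hy.symm
  -- For `p` fixing `E`, the value `p • x` depends only on `p a`.
  have hagree : ∀ p q : F.autGroup, (∀ y ∈ E, p.1 y = y) → (∀ y ∈ E, q.1 y = y) →
      p.1 a = q.1 a → p • x = q • x := by
    intro p q hp hq hpq
    rw [← inv_smul_eq_iff, smul_smul]
    refine hx _ fun y hy => ?_
    rcases Finset.mem_insert.1 hy with rfl | hy
    · exact q.1.symm_apply_eq.2 hpq
    · exact hmul _ _ (fun y hy => hinv q y (hq y hy)) hp y hy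
  -- Dividing by `h` reduces to a single `π` that fixes `E` and `x` but moves `a`.
  obtain ⟨π, rfl⟩ : ∃ π, g = h * π := ⟨h⁻¹ * g, by group⟩
  have hπ : ∀ y ∈ E, π.1 y = y := fun y hy => h.1.injective ((hg y hy).trans (hh y hy).symm)
  have hπx : π • x = x := by rwa [mul_smul, smul_left_cancel_iff] at hgh
  have hπa : π.1 a ≠ a := fun e => hne (congrArg h.1 e)
  refine hx' fun k hk => ?_
  by_cases hka : a = k.1 a
  · exact (hagree k 1 hk (fun _ _ => rfl) hka.symm).trans (one_smul _ x)
  -- Amalgamate the type of `π a` over `E ∪ {a}` with that of `k (π a)` over `E ∪ {k a}`. Then `σ π`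
  -- and `ρ k π` agree at `a`, hence on `x`; the former sends `x` to `x`, the latter to `k • x`.
  obtain ⟨σ, hσ, ρ, hρ, h1, h2, h3⟩ := exists_amalgam hF hF' (b := π.1 a) (b' := k.1 (π.1 a)) hka
    haE (hout k hk a haE)
    (fun h => (Finset.mem_insert.1 h).elim hπa (hout π hπ a haE))
    (fun h => (Finset.mem_insert.1 h).elim (fun e => hπa (k.1.injective e))
      (hout k hk _ (hout π hπ a haE)))
    (fun t ht y hy => by
      have hmap : (insert (π.1 a) t).map k.1.toEmbedding = insert (k.1 (π.1 a)) t := by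
        rw [Finset.map_eq_image, Finset.image_insert]
        congr 1
        refine (Finset.image_congr fun a ha => hk a (ht ha)).trans Finset.image_id'
      have := IsIso.picks_map_iff k.2 (insert (π.1 a) t) y
      rw [hmap, hk y (ht hy)] at this
      exact this.symm)
  lift σ to F.autGroup using hσ
  lift ρ to F.autGroup using hρ
  have hσE : ∀ y ∈ E, σ.1 y = y := fun y hy => h1 y (Finset.mem_insert_of_mem hy)
  have hρE : ∀ y ∈ E, ρ.1 y = y := fun y hy => h2 y (Finset.mem_insert_of_mem hy)
  have e1 : σ • x = x := hx σ h1
  have e2 : (ρ * k) • x = k • x := hagree _ _ (hmul _ _ hρE hk) hk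
    (h2 _ (Finset.mem_insert_self _ _))
  have e3 : (σ * π) • x = (ρ * k * π) • x :=
    hagree _ _ (hmul _ _ hσE hπ) (hmul _ _ (hmul _ _ hρE hk) hπ) h3
  rw [mul_smul σ, mul_smul _ π, hπx, e1, e2] at e3
  exact e3.symm

end Selector

/-! ### The action of permutations on the universe with atoms. -/

namespace PreZFA

variable {A : Type}

theorem perm_one (x : PreZFA.{u} A) : perm 1 x = x := by
  induction x with
  | atom a => rfl
  | set ι f ih => simp only [perm, ih]

theorem perm_mul (π ρ : Equiv.Perm A) (x : PreZFA.{u} A) :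
    perm (π * ρ) x = perm π (perm ρ x) := by
  induction x with
  | atom a => rfl
  | set ι f ih => simp only [perm, ih]

end PreZFA

namespace ZFA

variable {A : Type}

theorem ext {x y : ZFA.{u} A} (hx : ¬ IsAtom x) (hy : ¬ IsAtom y)
    (h : ∀ z, Mem z x ↔ Mem z y) : x = y := by
  induction x using Quotient.inductionOn with | _ x
  induction y using Quotient.inductionOn with | _ y
  cases x with
  | atom a => exact absurd trivial hx
  | set ι f =>
    cases y with
    | atom b => exact absurd trivial hy
    | set κ g =>
      refine Quotient.sound ⟨fun i => ?_, fun j => ?_⟩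
      · exact (h (Quotient.mk _ (f i))).1 ⟨i, PreZFA.Equal.refl _⟩
      · obtain ⟨i, hi⟩ := (h (Quotient.mk _ (g j))).2 ⟨j, PreZFA.Equal.refl _⟩
        exact ⟨i, hi.symm⟩

theorem exists_set {ι : Type u} (f : ι → ZFA.{u} A) :
    ∃ x : ZFA.{u} A, ¬ IsAtom x ∧ ∀ y, Mem y x ↔ ∃ i, y = f i := by
  refine ⟨Quotient.mk _ (.set ι fun i => (f i).out), id, fun y => ?_⟩
  induction y using Quotient.inductionOn with | _ y
  constructor
  · rintro ⟨i, hi⟩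
    exact ⟨i, (Quotient.sound hi).trans (Quotient.out_eq _)⟩
  · rintro ⟨i, hi⟩
    exact ⟨i, Quotient.exact (hi.trans (Quotient.out_eq _).symm)⟩

/-- Smallness is what separates sets from proper classes here; it is the size condition for
comprehension in the permutation model. -/
theorem small_mem (x : ZFA.{u} A) : Small.{u} {y // Mem y x} := by
  induction x using Quotient.inductionOn with | _ x
  cases x with
  | atom a =>
    have : IsEmpty {y : ZFA.{u} A // Mem y (Quotient.mk _ (.atom a))} := by
      refine ⟨fun y => ?_⟩
      obtain ⟨y, hy⟩ := y
      induction y using Quotient.inductionOn with | _ y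
      exact hy
    infer_instance
  | set ι f =>
    refine small_of_surjective (f := fun i : ι =>
      (⟨Quotient.mk _ (f i), i, PreZFA.Equal.refl _⟩ :
        {y : ZFA.{u} A // Mem y (Quotient.mk _ (.set ι f))})) ?_
    rintro ⟨y, hy⟩
    induction y using Quotient.inductionOn with | _ y
    obtain ⟨i, hi⟩ := hy
    exact ⟨i, Subtype.ext (Quotient.sound hi.symm)⟩

instance : MulAction (Equiv.Perm A) (ZFA.{u} A) where
  smul := perm
  one_smul x := by
    induction x using Quotient.inductionOn with | _ x
    exact congrArg (Quotient.mk _) (PreZFA.perm_one x)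
  mul_smul π ρ x := by
    induction x using Quotient.inductionOn with | _ x
    exact congrArg (Quotient.mk _) (PreZFA.perm_mul π ρ x)

theorem isAtom_smul_iff (π : Equiv.Perm A) (x : ZFA.{u} A) : IsAtom (π • x) ↔ IsAtom x := by
  induction x using Quotient.inductionOn with | _ x
  cases x <;> exact Iff.rfl

theorem Mem.smul (π : Equiv.Perm A) {x y : ZFA.{u} A} (h : Mem y x) : Mem (π • y) (π • x) := by
  induction x using Quotient.inductionOn with | _ x
  induction y using Quotient.inductionOn with | _ y
  cases x with
  | atom a => exact h
  | set ι f =>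
    obtain ⟨i, hi⟩ := h
    exact ⟨i, PreZFA.perm_congr π hi⟩

theorem mem_smul_iff (π : Equiv.Perm A) {x y : ZFA.{u} A} : Mem y (π • x) ↔ Mem (π⁻¹ • y) x := by
  constructor
  · intro h
    simpa using h.smul π⁻¹
  · intro h
    simpa using h.smul π

variable {G : Subgroup (Equiv.Perm A)}

/-- If `S` supports `x`, then `π[S]` supports `π • x`, by conjugation with `π`. -/
theorem IsSymmetric.smul {π : Equiv.Perm A} (hπ : π ∈ G) {x : ZFA.{u} A} (hx : IsSymmetric G x) :
    IsSymmetric G (π • x) := by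
  obtain ⟨S, hS⟩ := hx
  refine ⟨S.map π.toEmbedding, fun ρ hρ h => ?_⟩
  have key : (π⁻¹ * ρ * π) • x = x := by
    refine hS _ (G.mul_mem (G.mul_mem (G.inv_mem hπ) hρ) hπ) fun a ha => ?_
    have := h (π a) (Finset.mem_map_of_mem _ ha)
    simp [this]
  change ρ • π • x = π • x
  rwa [mul_smul, mul_smul, inv_smul_eq_iff] at key

theorem IsHereditarilySymmetric.smul {π : Equiv.Perm A} (hπ : π ∈ G) {x : ZFA.{u} A}
    (hx : IsHereditarilySymmetric G x) : IsHereditarilySymmetric G (π • x) := by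
  induction hx with
  | intro x hx _ ih =>
    refine ⟨_, hx.smul hπ, fun y hy => ?_⟩
    have := ih _ ((mem_smul_iff π).1 hy)
    rwa [smul_inv_smul] at this

theorem IsHereditarilySymmetric.isSymmetric {x : ZFA.{u} A} (h : IsHereditarilySymmetric G x) :
    IsSymmetric G x := by
  cases h; assumption

theorem IsHereditarilySymmetric.mem {x y : ZFA.{u} A} (h : IsHereditarilySymmetric G x)
    (hy : Mem y x) : IsHereditarilySymmetric G y := by
  cases h with | intro _ _ h => exact h y hy

end ZFA

/-! ### Set theory inside the permutation model. -/

namespace PermutationModel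

open SetAtomStructure

variable {A : Type} {G : Subgroup (Equiv.Perm A)}

/-- `g` fixes the set `E` of atoms pointwise. -/
def Fixes (E : Finset A) (g : G) : Prop := ∀ a ∈ E, g.1 a = a

theorem Fixes.inv {E : Finset A} {g : G} (h : Fixes E g) : Fixes E g⁻¹ :=
  fun a ha => g.1.symm_apply_eq.2 (h a ha).symm

theorem Fixes.mul {E : Finset A} {g h : G} (hg : Fixes E g) (hh : Fixes E h) : Fixes E (g * h) :=
  fun a ha => (congrArg g.1 (hh a ha)).trans (hg a ha)

theorem Fixes.mono {E E' : Finset A} {g : G} (hg : Fixes E g) (h : E' ⊆ E) : Fixes E' g :=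
  fun a ha => hg a (h ha)

instance : MulAction G (PermutationModel.{u} G) where
  smul g x := ⟨g.1 • x.1, x.2.smul g.2⟩
  one_smul x := Subtype.ext (one_smul (Equiv.Perm A) x.1)
  mul_smul g h x := Subtype.ext (mul_smul g.1 h.1 x.1)

theorem ext {x y : PermutationModel.{u} G} (hx : IsSet x) (hy : IsSet y)
    (h : ∀ z, z ∈ x ↔ z ∈ y) : x = y := by
  refine Subtype.ext (ZFA.ext hx hy fun z => ⟨fun hz => ?_, fun hz => ?_⟩)
  · exact (h ⟨z, x.2.mem hz⟩).1 hz
  · exact (h ⟨z, y.2.mem hz⟩).2 hz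

theorem mem_induction {P : PermutationModel.{u} G → Prop} (h : ∀ x, (∀ y, y ∈ x → P y) → P x)
    (x : PermutationModel.{u} G) : P x := by
  obtain ⟨x, hx⟩ := x
  have hx' := hx
  induction hx' with
  | intro x h1 h2 ih => exact h _ fun y hy => ih y.1 hy y.2

theorem mem_smul_iff (g : G) {x y : PermutationModel.{u} G} : y ∈ g • x ↔ g⁻¹ • y ∈ x :=
  ZFA.mem_smul_iff g.1

theorem smul_mem_smul_iff (g : G) {x y : PermutationModel.{u} G} : g • y ∈ g • x ↔ y ∈ x := by
  rw [mem_smul_iff, inv_smul_smul]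

theorem isSet_smul_iff (g : G) {x : PermutationModel.{u} G} : IsSet (g • x) ↔ IsSet x :=
  not_congr (ZFA.isAtom_smul_iff g.1 x.1)

theorem exists_support (x : PermutationModel.{u} G) :
    ∃ E : Finset A, ∀ g : G, Fixes E g → g • x = x := by
  obtain ⟨E, hE⟩ := x.2.isSymmetric
  exact ⟨E, fun g hg => Subtype.ext (hE g.1 g.2 hg)⟩

theorem small_mem (x : PermutationModel.{u} G) : Small.{u} {y // y ∈ x} := by
  have := ZFA.small_mem x.1
  exact small_of_injective (β := {y // ZFA.Mem y x.1}) (f := fun y => ⟨y.1.1, y.2⟩) fun y z h =>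
    Subtype.ext (Subtype.ext (Subtype.mk.inj h))

/-- Comprehension: a small class with a finite support is a set of the permutation model. -/
theorem exists_set (P : PermutationModel.{u} G → Prop) [Small.{u} {y // P y}] (E : Finset A)
    (hE : ∀ g : G, Fixes E g → ∀ y, P y → P (g • y)) :
    ∃ x : PermutationModel.{u} G, IsSet x ∧ ∀ y, y ∈ x ↔ P y := by
  obtain ⟨x, hx, h⟩ := ZFA.exists_set
    (fun i : Shrink.{u} {y // P y} => ((equivShrink {y // P y}).symm i).1.1)
  have h' : ∀ y, ZFA.Mem y x ↔ ∃ z : PermutationModel.{u} G, z.1 = y ∧ P z := by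
    intro y
    rw [h]
    constructor
    · rintro ⟨i, rfl⟩
      exact ⟨_, rfl, ((equivShrink {y // P y}).symm i).2⟩
    · rintro ⟨z, rfl, hz⟩
      exact ⟨equivShrink {y // P y} ⟨z, hz⟩, by simp⟩
  have hs : ∀ g : G, Fixes E g → ∀ y, ZFA.Mem y x → ZFA.Mem (g.1 • y) x := by
    intro g hg y hy
    obtain ⟨z, rfl, hz⟩ := (h' y).1 hy
    exact (h' _).2 ⟨g • z, rfl, hE g hg z hz⟩
  refine ⟨⟨x, .intro _ ⟨E, fun π hπ hfix => ?_⟩ fun y hy => ?_⟩, hx, fun y => ?_⟩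
  · refine ZFA.ext (fun h => hx ((ZFA.isAtom_smul_iff π x).1 h)) hx fun z => ?_
    refine (ZFA.mem_smul_iff π).trans ⟨fun hz => ?_, fun hz => ?_⟩
    · simpa using hs ⟨π, hπ⟩ hfix _ hz
    · exact hs (⟨π, hπ⟩ : G)⁻¹ (Fixes.inv hfix) z hz
  · obtain ⟨z, rfl, -⟩ := (h' y).1 hy
    exact z.2
  · refine (h' y.1).trans ⟨?_, fun hy => ⟨y, rfl, hy⟩⟩
    rintro ⟨z, hz, hP⟩
    rwa [← Subtype.ext hz]

section Pairs

theorem exists_isPair (a b : PermutationModel.{u} G) : ∃ p, IsPair p a b := by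
  classical
  obtain ⟨E, hE⟩ := exists_support a
  obtain ⟨E', hE'⟩ := exists_support b
  have : Small.{u} {y // y = a ∨ y = b} := by
    have : ({y | y = a ∨ y = b} : Set (PermutationModel.{u} G)) = {a, b} := rfl
    change Small.{u} ({y | y = a ∨ y = b} : Set (PermutationModel.{u} G))
    rw [this]
    infer_instance
  exact exists_set (fun y => y = a ∨ y = b) (E ∪ E') (by
    rintro g hg _ (rfl | rfl)
    · exact .inl (hE g (hg.mono Finset.subset_union_left))
    · exact .inr (hE' g (hg.mono Finset.subset_union_right)))

theorem exists_isOrderedPair (a b : PermutationModel.{u} G) : ∃ p, IsOrderedPair p a b := by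
  obtain ⟨s, hs⟩ := exists_isPair a a
  obtain ⟨t, ht⟩ := exists_isPair a b
  obtain ⟨p, hp⟩ := exists_isPair s t
  exact ⟨p, s, t, hs, ht, hp⟩

variable {p q a b c d : PermutationModel.{u} G}

theorem isPair_unique (hp : IsPair p a b) (hq : IsPair q a b) : p = q :=
  ext hp.1 hq.1 fun z => (hp.2 z).trans (hq.2 z).symm

theorem isOrderedPair_unique (hp : IsOrderedPair p a b) (hq : IsOrderedPair q a b) : p = q := by
  obtain ⟨s, t, hs, ht, hp⟩ := hp
  obtain ⟨s', t', hs', ht', hq⟩ := hq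
  obtain rfl := isPair_unique hs hs'
  obtain rfl := isPair_unique ht ht'
  exact isPair_unique hp hq

theorem isPair_inj (hp : IsPair p a b) (hp' : IsPair p c d) :
    a = c ∧ b = d ∨ a = d ∧ b = c := by
  have h1 := (hp'.2 a).1 ((hp.2 a).2 (.inl rfl))
  have h2 := (hp'.2 b).1 ((hp.2 b).2 (.inr rfl))
  have h3 := (hp.2 c).1 ((hp'.2 c).2 (.inl rfl))
  have h4 := (hp.2 d).1 ((hp'.2 d).2 (.inr rfl))
  grind

theorem isOrderedPair_inj (hp : IsOrderedPair p a b) (hp' : IsOrderedPair p c d) :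
    a = c ∧ b = d := by
  obtain ⟨s, t, hs, ht, hp⟩ := hp
  obtain ⟨s', t', hs', ht', hp'⟩ := hp'
  rcases isPair_inj hp hp' with ⟨rfl, rfl⟩ | ⟨rfl, rfl⟩
  · have h1 := isPair_inj hs hs'
    have h2 := isPair_inj ht ht'
    grind
  · have h1 := isPair_inj hs ht'
    have h2 := isPair_inj ht hs'
    grind

theorem isPair_smul (g : G) (hp : IsPair p a b) : IsPair (g • p) (g • a) (g • b) := by
  refine ⟨(isSet_smul_iff g).2 hp.1, fun z => ?_⟩
  rw [mem_smul_iff, hp.2, inv_smul_eq_iff, inv_smul_eq_iff]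

theorem isOrderedPair_smul (g : G) (hp : IsOrderedPair p a b) :
    IsOrderedPair (g • p) (g • a) (g • b) := by
  obtain ⟨s, t, hs, ht, hp⟩ := hp
  exact ⟨_, _, isPair_smul g hs, isPair_smul g ht, isPair_smul g hp⟩

end Pairs

/-- By ∈-induction: a nonempty `n` is `k ∪ {k}`, and `k` is again natural. -/
theorem finite_of_isNatural (n : PermutationModel.{u} G) (hn : IsNatural n) :
    {y | y ∈ n}.Finite := by
  induction n using mem_induction with
  | h n ih =>
    obtain ⟨h1, h2, h3, h4⟩ := hn
    rcases h3 with h3 | ⟨k, hk⟩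
    · convert Set.finite_empty
      ext y
      simpa using h3 y
    · have hkn : k ∈ n := (hk k).2 (.inr rfl)
      have hsub : ∀ y, y ∈ k → y ∈ n := fun y hy => h1.2 k hkn y hy
      have := ih k hkn ⟨h2 k hkn, fun y hy => h2 y (hsub y hy), h4 k hkn,
        fun y hy => h4 y (hsub y hy)⟩
      refine (this.insert k).subset fun y hy => ?_
      exact ((hk y).1 hy).symm

/-- Used contrapositively: a set of the model with infinitely many elements is infinite in the
model. -/
theorem finite_of_isFinite {X : PermutationModel.{u} G} (hX : IsFinite X) : {y | y ∈ X}.Finite := by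
  classical
  obtain ⟨-, n, f, hn, ⟨-, hf, hf'⟩, -, hb⟩ := hX
  choose φ hφ hφ' using hf'
  refine ((finite_of_isNatural n hn).image fun a => if h : a ∈ n then φ a h else a).subset ?_
  intro b hbX
  obtain ⟨a, hab, -⟩ := hb b hbX
  obtain ⟨p, hp, hpab⟩ := hab
  obtain ⟨a', b', ha', hp'⟩ := hf p hp
  obtain ⟨rfl, rfl⟩ := isOrderedPair_inj hp' hpab
  refine ⟨a', ha', ?_⟩
  simp only [dif_pos ha']
  exact (hφ' a' ha' _ ⟨p, hp, hpab⟩).symm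

theorem isSubset_smul {z Y : PermutationModel.{u} G} {g : G} (hg : g • Y = Y)
    (h : IsSubset z Y) : IsSubset (g • z) Y := by
  refine ⟨(isSet_smul_iff g).2 h.1, fun w hw => ?_⟩
  rw [mem_smul_iff] at hw
  rw [← hg, mem_smul_iff]
  exact h.2 _ hw

theorem hasCard_smul {m : ℕ} {z : PermutationModel.{u} G} (g : G) (h : HasCard m z) :
    HasCard m (g • z) := by
  obtain ⟨hz, x, hx, h⟩ := h
  refine ⟨(isSet_smul_iff g).2 hz, fun i => g • x i, fun i j e => hx (smul_left_cancel g e),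
    fun y => ?_⟩
  rw [mem_smul_iff, h]
  simp only [inv_smul_eq_iff]

theorem small_subsets (Y : PermutationModel.{u} G) (P : PermutationModel.{u} G → Prop) :
    Small.{u} {z // IsSubset z Y ∧ P z} := by
  have := small_mem Y
  refine small_of_injective (β := Set {y // y ∈ Y}) (f := fun z => {y | y.1 ∈ z.1}) fun z w h => ?_
  refine Subtype.ext (ext z.2.1.1 w.2.1.1 fun y => ⟨fun hy => ?_, fun hy => ?_⟩)
  · exact (Set.ext_iff.1 h ⟨y, z.2.1.2 y hy⟩).1 hy
  · exact (Set.ext_iff.1 h ⟨y, w.2.1.2 y hy⟩).2 hy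

/-- A choice relation on the `m`-element subsets of `Y` with a finite support yields a choice
function inside the permutation model. -/
theorem exists_choiceFunction {m : ℕ} {Y : PermutationModel.{u} G} {E : Finset A}
    (hY : ∀ g : G, Fixes E g → g • Y = Y)
    (C : PermutationModel.{u} G → PermutationModel.{u} G → Prop)
    (hC : ∀ g : G, Fixes E g → ∀ z y, C z y → C (g • z) (g • y))
    (hex : ∀ z, IsSubset z Y → HasCard m z → ∃! y, C z y) (hmem : ∀ z y, C z y → y ∈ z) :
    ∃ D f : PermutationModel.{u} G, IsSubsetsOfCard m D Y ∧ IsChoiceFunction f D := by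
  have := small_subsets Y (HasCard m)
  obtain ⟨D, hD, hDmem⟩ := exists_set (fun z => IsSubset z Y ∧ HasCard m z) E
    fun g hg z hz => ⟨isSubset_smul (hY g hg) hz.1, hasCard_smul g hz.2⟩
  have hex' : ∀ z, z ∈ D → ∃! y, C z y := fun z hz =>
    hex z ((hDmem z).1 hz).1 ((hDmem z).1 hz).2
  -- The chosen `y` is determined by `z`, so the pairs inject into `D`.
  have hsmall : Small.{u} {p // ∃ z y, z ∈ D ∧ C z y ∧ IsOrderedPair p z y} := by
    have := small_mem D
    refine small_of_injective (β := {z // z ∈ D})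
      (f := fun p => ⟨p.2.choose, p.2.choose_spec.choose_spec.1⟩) ?_
    intro p q h
    have hpq : p.2.choose = q.2.choose := congrArg Subtype.val h
    obtain ⟨h1, h2, h3⟩ := p.2.choose_spec.choose_spec
    obtain ⟨h4, h5, h6⟩ := q.2.choose_spec.choose_spec
    generalize p.2.choose_spec.choose = y at h2 h3
    rw [hpq] at h2 h3
    rw [(hex' _ h4).unique h2 h5] at h3
    exact Subtype.ext (isOrderedPair_unique h3 h6)
  obtain ⟨f, hf, hfmem⟩ := exists_set (fun p => ∃ z y, z ∈ D ∧ C z y ∧ IsOrderedPair p z y) E (by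
    rintro g hg p ⟨z, y, hz, hzy, hp⟩
    refine ⟨g • z, g • y, ?_, hC g hg z y hzy, isOrderedPair_smul g hp⟩
    rw [hDmem] at hz ⊢
    exact ⟨isSubset_smul (hY g hg) hz.1, hasCard_smul g hz.2⟩)
  have hmaps : ∀ z y, Maps f z y ↔ z ∈ D ∧ C z y := by
    intro z y
    constructor
    · rintro ⟨p, hp, hzy⟩
      obtain ⟨z', y', hz, hC, hp'⟩ := (hfmem p).1 hp
      obtain ⟨rfl, rfl⟩ := isOrderedPair_inj hp' hzy
      exact ⟨hz, hC⟩
    · rintro ⟨hz, hzy⟩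
      obtain ⟨p, hp⟩ := exists_isOrderedPair z y
      exact ⟨p, (hfmem p).2 ⟨z, y, hz, hzy, hp⟩, hp⟩
  refine ⟨D, f, ⟨hD, hDmem⟩, ⟨hf, fun p hp => ?_, fun z hz => ?_⟩, fun z y hzy => ?_⟩
  · obtain ⟨z, y, hz, -, hp⟩ := (hfmem p).1 hp
    exact ⟨z, y, hz, hp⟩
  · simpa only [hmaps, hz, true_and] using hex' z hz
  · exact hmem z y ((hmaps z y).1 hzy).2

/-- If all elements of `Y` have a common finite support, `[Y]^m` has a choice function. -/
theorem exists_choiceFunction_of_fixed {m : ℕ} (hm : 0 < m) {Y : PermutationModel.{u} G}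
    {E : Finset A} (hY : ∀ g : G, Fixes E g → g • Y = Y)
    (hE : ∀ y, y ∈ Y → ∀ g : G, Fixes E g → g • y = y) :
    ∃ D f : PermutationModel.{u} G, IsSubsetsOfCard m D Y ∧ IsChoiceFunction f D := by
  -- An arbitrary external choice suffices: each `g` fixing `E` fixes every subset of `Y` and all
  -- its elements, so equivariance is automatic.
  have hc : ∀ z : PermutationModel.{u} G, ∃ y, (∃ y', y' ∈ z) → y ∈ z := fun z => by
    by_cases h : ∃ y', y' ∈ z
    · exact ⟨h.choose, fun _ => h.choose_spec⟩
    · exact ⟨z, fun h' => absurd h' h⟩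
  choose c hc using hc
  refine exists_choiceFunction hY (fun z y => IsSubset z Y ∧ y ∈ z ∧ y = c z) ?_ ?_
    fun z y h => h.2.1
  · rintro g hg z y ⟨hz, hy, hyc⟩
    have hgz : g • z = z := by
      refine ext ((isSet_smul_iff g).2 hz.1) hz.1 fun w => ?_
      rw [mem_smul_iff]
      constructor
      · intro hw
        have := hE _ (hz.2 _ hw) g hg
        rw [smul_inv_smul] at this
        rwa [← this] at hw
      · intro hw
        rwa [hE w (hz.2 w hw) _ hg.inv]
    rw [hgz, hE y (hz.2 y hy) g hg]
    exact ⟨hz, hy, hyc⟩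
  · rintro z hz ⟨-, x, -, hx⟩
    have : ∃ y, y ∈ z := ⟨x ⟨0, hm⟩, (hx _).2 ⟨_, rfl⟩⟩
    exact ⟨c z, ⟨hz, hc z this, rfl⟩, fun y hy => hy.2.2⟩

end PermutationModel

/-! ### Orbits over a support, and `RC_m`. -/

/-- When the atoms of `T` are added to `S` one by one, `P` turns from false to true at some atom;
monotonicity of `P` is not needed. -/
theorem exists_support_insert {A : Type*} [DecidableEq A] {P : Finset A → Prop} {S T : Finset A}
    (hS : ¬ P S) (hT : P (T ∪ S)) : ∃ E a, S ⊆ E ∧ P (insert a E) ∧ ¬ P E := by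
  induction T using Finset.induction_on with
  | empty => exact absurd (by simpa using hT) hS
  | insert a T _ ih =>
    by_cases h : P (T ∪ S)
    · exact ih h
    · exact ⟨T ∪ S, a, Finset.subset_union_right, by rwa [← Finset.insert_union], h⟩

namespace PermutationModel

open SetAtomStructure

/-- The orbit of `x` over `E` inherits a selector from the atoms if `x` is supported by `E` and one
further atom, but not by `E`. -/
theorem exists_orbit_choiceFunction {m : ℕ} {F : Selector m ℕ} (hF : F.HasExtension)
    (hF' : F.IsHomogeneous) {x : PermutationModel.{u} F.autGroup} {E : Finset ℕ} {a : ℕ}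
    (hx : ∀ g : F.autGroup, Fixes (insert a E) g → g • x = x)
    (hx' : ¬ ∀ g : F.autGroup, Fixes E g → g • x = x) :
    ∃ Y : PermutationModel.{u} F.autGroup, IsInfinite Y ∧
      (∀ y, y ∈ Y → ∃ g : F.autGroup, Fixes E g ∧ y = g • x) ∧
      ∃ D f, IsSubsetsOfCard m D Y ∧ IsChoiceFunction f D := by
  classical
  have haE : a ∉ E := fun ha => hx' (by rwa [Finset.insert_eq_of_mem ha] at hx)
  have hinj : ∀ g h : F.autGroup, Fixes E g → Fixes E h → g • x = h • x → g.1 a = h.1 a :=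
    fun g h hg hh => Selector.apply_eq_of_smul_eq hF hF' hx hx' hg hh
  have hagree : ∀ g h : F.autGroup, Fixes E g → Fixes E h → g.1 a = h.1 a → g • x = h • x := by
    intro g h hg hh hgh
    rw [← inv_smul_eq_iff, smul_smul]
    refine hx _ fun y hy => ?_
    rcases Finset.mem_insert.1 hy with rfl | hy
    · exact h.1.symm_apply_eq.2 hgh
    · exact hh.inv.mul hg y hy
  -- `φ` reads the atom `g a` off `g • x`; `hinj` makes it independent of `g`. The value 0 off the
  -- orbit plays no role.
  obtain ⟨φ, hφ⟩ : ∃ φ : PermutationModel.{u} F.autGroup → ℕ,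
      ∀ g : F.autGroup, Fixes E g → φ (g • x) = g.1 a := by
    refine ⟨fun y => if h : ∃ g : F.autGroup, Fixes E g ∧ y = g • x then h.choose.1 a else 0,
      fun g hg => ?_⟩
    have h : ∃ g' : F.autGroup, Fixes E g' ∧ g • x = g' • x := ⟨g, hg, rfl⟩
    simp only [dif_pos h]
    exact (hinj _ _ hg h.choose_spec.1 h.choose_spec.2).symm
  have hsmall : Small.{u} {y // ∃ g : F.autGroup, Fixes E g ∧ y = g • x} := by
    refine small_of_injective (β := ℕ) (f := fun y => φ y.1) ?_
    rintro ⟨_, g, hg, rfl⟩ ⟨_, h, hh, rfl⟩ e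
    simp only [hφ g hg, hφ h hh] at e
    exact Subtype.ext (hagree g h hg hh e)
  obtain ⟨Y, hY, hYmem⟩ := exists_set (fun y => ∃ g : F.autGroup, Fixes E g ∧ y = g • x) E (by
    rintro g hg _ ⟨h, hh, rfl⟩
    exact ⟨g * h, hg.mul hh, (mul_smul g h x).symm⟩)
  have hφg : ∀ g : F.autGroup, Fixes E g → ∀ y, y ∈ Y → φ (g • y) = g.1 (φ y) := by
    intro g hg y hy
    obtain ⟨h, hh, rfl⟩ := (hYmem y).1 hy
    rw [smul_smul, hφ _ (hg.mul hh), hφ h hh]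
    rfl
  have hφinj : ∀ y, y ∈ Y → ∀ w, w ∈ Y → φ y = φ w → y = w := by
    intro y hy w hw e
    obtain ⟨g, hg, rfl⟩ := (hYmem y).1 hy
    obtain ⟨h, hh, rfl⟩ := (hYmem w).1 hw
    rw [hφ g hg, hφ h hh] at e
    exact hagree g h hg hh e
  have hYsupp : ∀ g : F.autGroup, Fixes E g → g • Y = Y := by
    have : ∀ g : F.autGroup, Fixes E g → ∀ y, y ∈ Y → g • y ∈ Y := by
      intro g hg y hy
      obtain ⟨h, hh, rfl⟩ := (hYmem y).1 hy
      exact (hYmem _).2 ⟨g * h, hg.mul hh, (mul_smul g h x).symm⟩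
    intro g hg
    refine ext ((isSet_smul_iff g).2 hY) hY fun w => ?_
    rw [mem_smul_iff]
    exact ⟨fun hw => by simpa using this g hg _ hw, fun hw => this _ hg.inv _ hw⟩
  refine ⟨Y, ⟨hY, fun hfin => ?_⟩, fun y => (hYmem y).1, ?_⟩
  -- `φ` maps `Y` onto the orbit of `a` over `E`, which leaves every finite set.
  · have := (finite_of_isFinite hfin).image φ
    obtain ⟨π, hπ, hfix, hv⟩ := Selector.exists_aut_notMem hF hF' haE this.toFinset
    refine hv (this.mem_toFinset.2 ⟨(⟨π, hπ⟩ : F.autGroup) • x, ?_, hφ _ hfix⟩)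
    exact (hYmem _).2 ⟨⟨π, hπ⟩, hfix, rfl⟩
  -- From `z` choose the element whose atom `F` selects from `T = φ[z]`. This is invariant because
  -- `φ` is equivariant and each `g` preserves `Sel`.
  · refine exists_choiceFunction hYsupp (fun z y => IsSubset z Y ∧ y ∈ z ∧
      ∃ T : Finset ℕ, (∀ n, n ∈ T ↔ ∃ w, w ∈ z ∧ φ w = n) ∧ F.Picks T (φ y)) ?_ ?_
      fun z y h => h.2.1
    · rintro g hg z y ⟨hz, hy, T, hT, hp⟩
      refine ⟨isSubset_smul (hYsupp g hg) hz, (smul_mem_smul_iff g).2 hy,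
        T.map g.1.toEmbedding, fun n => ?_, ?_⟩
      · rw [Finset.mem_map_equiv, hT]
        constructor
        · rintro ⟨w, hw, e⟩
          refine ⟨g • w, (smul_mem_smul_iff g).2 hw, ?_⟩
          rw [hφg g hg w (hz.2 w hw), e]
          exact g.1.apply_symm_apply n
        · rintro ⟨w, hw, rfl⟩
          rw [mem_smul_iff] at hw
          refine ⟨_, hw, ?_⟩
          have := hφg g hg _ (hz.2 _ hw)
          rw [smul_inv_smul] at this
          rw [this]
          exact (g.1.symm_apply_apply _).symm
      · rw [hφg g hg y (hz.2 y hy)]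
        exact (Selector.IsIso.picks_map_iff g.2 T (φ y)).2 hp
    · rintro z hz ⟨-, v, hv, hvz⟩
      have hvY : ∀ i, v i ∈ Y := fun i => hz.2 _ ((hvz _).2 ⟨i, rfl⟩)
      have hcard : (Finset.univ.image fun i => φ (v i)).card = m := by
        rw [Finset.card_image_of_injective _ fun i j e => hv (hφinj _ (hvY i) _ (hvY j) e)]
        simp
      obtain ⟨n, hn, hpick⟩ := F.exists_picks hcard
      obtain ⟨i, -, rfl⟩ := Finset.mem_image.1 hn
      have hT : ∀ n, n ∈ (Finset.univ.image fun i => φ (v i)) ↔ ∃ w, w ∈ z ∧ φ w = n := by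
        intro n
        simp only [Finset.mem_image, Finset.mem_univ, true_and, hvz]
        exact ⟨fun ⟨i, e⟩ => ⟨_, ⟨i, rfl⟩, e⟩, fun ⟨w, ⟨i, e⟩, e'⟩ => ⟨i, e ▸ e'⟩⟩
      refine ⟨v i, ⟨hz, (hvz _).2 ⟨i, rfl⟩, _, hT, hpick⟩, ?_⟩
      rintro y ⟨-, hy, T, hT', hp⟩
      obtain rfl : T = _ := Finset.ext fun n => (hT' n).trans (hT n).symm
      exact hφinj _ (hz.2 y hy) _ (hvY i) (hp.unique hpick)

theorem satisfiesRC {m : ℕ} (hm : 0 < m) {F : Selector m ℕ} (hF : F.HasExtension)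
    (hF' : F.IsHomogeneous) : SatisfiesRC m (PermutationModel.{u} F.autGroup) := by
  intro X hX
  obtain ⟨S, hS⟩ := exists_support X
  by_cases hall : ∀ y, y ∈ X → ∀ g : F.autGroup, Fixes S g → g • y = y
  · exact ⟨X, ⟨hX.1, fun _ h => h⟩, hX, exists_choiceFunction_of_fixed hm hS hall⟩
  · push Not at hall
    obtain ⟨x, hxX, hx⟩ := hall
    obtain ⟨T, hT⟩ := exists_support x
    obtain ⟨E, a, hSE, h1, h2⟩ := exists_support_insert
      (P := fun E => ∀ g : F.autGroup, Fixes E g → g • x = x) (S := S) (T := T)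
      (by push Not; exact hx) fun g hg => hT g (hg.mono Finset.subset_union_left)
    obtain ⟨Y, hY, hYx, hc⟩ := exists_orbit_choiceFunction hF hF' h1 h2
    refine ⟨Y, ⟨hY.1, fun y hy => ?_⟩, hY, hc⟩
    obtain ⟨g, hg, rfl⟩ := hYx y hy
    -- `g` fixes `E ⊇ S`, hence fixes `X`, so the orbit of `x` stays inside `X`.
    rw [← hS g (hg.mono hSE), smul_mem_smul_iff]
    exact hxX

end PermutationModel

theorem theorem2p2 (m : ℕ) (hm : 0 < m) :
    (∃ F : Selector m ℕ, F.IsUniversal ∧ F.IsHomogeneous) ∧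
    ∀ F : Selector m ℕ, F.IsUniversal → F.IsHomogeneous →
      SetAtomStructure.SatisfiesRC m (PermutationModel.{u} F.autGroup) := by
  obtain ⟨F, hF⟩ := Selector.exists_hasExtension hm
  exact ⟨⟨F, hF.isUniversal hm, hF.isHomogeneous⟩, fun F hF hF' =>
    PermutationModel.satisfiesRC hm (hF.hasExtension hF') hF'⟩
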